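/- Let $n$ be a natural number and let $\operatorname{Lo}_n^1$ be the group of real lower triangular $n\times n$ matrices with all diagonal entries equal to $1$. For a real $n\times n$ matrix $L$ and $1\le k\le n-1$, let $\operatorname{swminor}(L,k)$ be the $k\times k$ submatrix of $L$ formed by its last $k$ rows and its first $k$ columns. Let $N_0$ be a real $n\times n$ matrix whose subdiagonal entries, in positions $(j+1,j)$, are strictly positive, and all of whose other entries are zero (so $N_0$ is nilpotent and lower triangular). Then there exists $L_0\in\operatorname{Lo}_n^1$ such that, for the curve $\Gamma(t)=L_0\exp(tN_0)$, $t\in\mathbb{R}$, and for every $k=1,\dots,n-1$, the function $m_k(t)=\det(\operatorname{swminor}(\Gamma(t),k))$ is a real polynomial in $t$ of degree $k(n-k)$ all of whose complex roots are real and simple. Furthermore, $L_0$ can be chosen so that, in addition, $m_{k_1}$ and $m_{k_2}$ have no common root whenever $k_1\neq k_2$, and hence so that the polynomials $m_1,\dots,m_{n-1}$ have in total exactly $(n^3-n)/6$ roots, all real and distinct. -/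

import Mathlib

/-- The group of real lower triangular `n × n` matrices with unit diagonal (as a set). -/
def Lo1 (n : ℕ) : Set (Matrix (Fin n) (Fin n) ℝ) :=
  {L | (∀ i, L i i = 1) ∧ ∀ i j, i < j → L i j = 0}

/-- The matrices with strictly positive entries in the positions `(j + 1, j)` and zero entries
elsewhere (these are in particular nilpotent and lower triangular). -/
def posSubdiagonal (n : ℕ) : Set (Matrix (Fin n) (Fin n) ℝ) :=
  {A | ∀ i j : Fin n,
    ((i : ℕ) = (j : ℕ) + 1 → 0 < A i j) ∧ ((i : ℕ) ≠ (j : ℕ) + 1 → A i j = 0)}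

/-- The southwest `k × k` submatrix, formed by the last `k` rows and the first `k` columns. -/
def swminor {n : ℕ} (L : Matrix (Fin n) (Fin n) ℝ) (k : ℕ) (hk : k ≤ n) :
    Matrix (Fin k) (Fin k) ℝ :=
  L.submatrix (fun i : Fin k => (⟨n - k + (i : ℕ), by omega⟩ : Fin n))
    (fun j : Fin k => Fin.castLE hk j)

/-- The curve `t ↦ L₀ exp (t N₀)`. -/
noncomputable def polyCurve {n : ℕ} (N₀ L₀ : Matrix (Fin n) (Fin n) ℝ) (t : ℝ) :
    Matrix (Fin n) (Fin n) ℝ :=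
  L₀ * NormedSpace.exp (t • N₀)

/-- The function `m_k` of a matrix curve: the determinant of its southwest `k × k` submatrix. -/
noncomputable def mFun {n : ℕ} (Γ : ℝ → Matrix (Fin n) (Fin n) ℝ) (k : ℕ) (hk : k ≤ n) (t : ℝ) :
    ℝ :=
  (swminor (Γ t) k hk).det

/-! Conjugating `N₀` by a positive diagonal matrix turns it into the standard shift, so every minor
of `exp (t N₀)` on the first `k` columns is a positive constant times a power of `t`. By
Cauchy–Binet (`exists_weights`), `m_k` is therefore a positively weighted sum of minors of `L₀` on
its last `k` rows, the column set `f` contributing to `t ^ codeg f`.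

At `L₀ = 1` each `m_k` is a positive multiple of `t ^ (k (n - k))`. Now add a small multiple `ε > 0`
of a column to its left neighbour. All these minors stay nonnegative, so nothing cancels: the order
of each `m_k` at `0` drops by at most one, and a suitable column lowers at least one order. When it
drops, one simple real root leaves `0`, while the nonzero simple roots survive by a sign-change
argument. Repeating (`IsStage.exists_lt`) makes every order zero, hence all roots real and simple.

Common roots are removed by small row operations, which fix `m_k` for `k ≤ m` and perturb `m_{m+1}`.
If none of them could make `m_{m+1}` nonzero at `x`, then `m_m` would have a double root at `x`
(`exists_firstRowDet_ne_zero`), contrary to simplicity. -/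

section

/-! ### Stability of simple real roots -/

open Filter Topology Polynomial

/-- `p` has degree at most `d` and `d` distinct real roots. -/
def RealSimple (p : ℝ[X]) (d : ℕ) : Prop :=
  p ≠ 0 ∧ p.natDegree ≤ d ∧ ∃ s : Finset ℝ, s.card = d ∧ ∀ x ∈ s, p.eval x = 0

namespace RealSimple

variable {p : ℝ[X]} {d : ℕ}

theorem exists_roots_eq (h : RealSimple p d) : ∃ s : Finset ℝ, s.card = d ∧ p.roots = s.val := by
  obtain ⟨h0, hd, s, hs, hr⟩ := h
  refine ⟨s, hs, ?_⟩
  have hle : s.val ≤ p.roots := by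
    rw [Multiset.le_iff_subset s.nodup]
    intro x hx
    exact (mem_roots h0).2 (hr x hx)
  refine (Multiset.eq_of_le_of_card_le hle ?_).symm
  calc _ ≤ p.natDegree := p.card_roots'
    _ ≤ _ := by rw [Finset.card_val, hs]; exact hd

theorem nodup_roots (h : RealSimple p d) : p.roots.Nodup := by
  obtain ⟨s, -, hs⟩ := h.exists_roots_eq
  rw [hs]; exact s.nodup

theorem card_roots (h : RealSimple p d) : Multiset.card p.roots = d := by
  obtain ⟨s, hs, hs'⟩ := h.exists_roots_eq
  rw [hs', Finset.card_val, hs]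

theorem natDegree_eq (h : RealSimple p d) : p.natDegree = d :=
  le_antisymm h.2.1 (h.card_roots ▸ p.card_roots')

theorem derivative_eval_ne_zero (h : RealSimple p d) {x : ℝ} (hx : p.eval x = 0) :
    p.derivative.eval x ≠ 0 := by
  intro hd
  have := (one_lt_rootMultiplicity_iff_isRoot h.1).2 ⟨hx, hd⟩
  have h2 := Multiset.nodup_iff_count_le_one.1 h.nodup_roots x
  rw [count_roots] at h2
  omega

theorem complex_roots (h : RealSimple p d) {z : ℂ} (hz : (p.map (algebraMap ℝ ℂ)).IsRoot z) :
    z.im = 0 ∧ (p.map (algebraMap ℝ ℂ)).rootMultiplicity z = 1 := by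
  have hinj : Function.Injective (algebraMap ℝ ℂ) := (algebraMap ℝ ℂ).injective
  have hroots := roots_map_of_injective_of_card_eq_natDegree hinj
    (h.card_roots.trans h.natDegree_eq.symm)
  have h0 : p.map (algebraMap ℝ ℂ) ≠ 0 := (Polynomial.map_ne_zero_iff hinj).2 h.1
  have hz' := (mem_roots h0).2 hz
  have hnd := h.nodup_roots.map hinj
  rw [hroots] at hnd
  refine ⟨?_, ?_⟩
  · rw [← hroots, Multiset.mem_map] at hz'
    obtain ⟨x, -, rfl⟩ := hz'
    exact Complex.ofReal_im x
  · rw [← count_roots]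
    exact Multiset.count_eq_one_of_mem hnd hz'

end RealSimple

theorem tendsto_eval_of_tendsto_coeff {α : Type*} {l : Filter α} {R : α → ℝ[X]} {R₀ : ℝ[X]} {d : ℕ}
    (hd : ∀ a, (R a).natDegree ≤ d) (hd₀ : R₀.natDegree ≤ d)
    (hc : ∀ i, Tendsto (fun a => (R a).coeff i) l (𝓝 (R₀.coeff i))) (y : ℝ) :
    Tendsto (fun a => (R a).eval y) l (𝓝 (R₀.eval y)) := by
  simp only [eval_eq_sum_range' (Nat.lt_succ_of_le (hd _)),
    eval_eq_sum_range' (Nat.lt_succ_of_le hd₀)]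
  exact tendsto_finsetSum _ fun i _ => (hc i).mul_const _

theorem eventually_eval_mul_eval_neg {p : ℝ[X]} {x : ℝ} (hx : p.eval x = 0)
    (hx' : p.derivative.eval x ≠ 0) :
    ∀ᶠ δ in 𝓝[>] (0 : ℝ), p.eval (x - δ) * p.eval (x + δ) < 0 := by
  obtain ⟨q, rfl⟩ := dvd_iff_isRoot.2 hx
  have hq : q.eval x ≠ 0 := by simpa using hx'
  have hcont : Continuous fun δ : ℝ => q.eval (x - δ) * q.eval (x + δ) := by
    have := q.continuous
    fun_prop
  have hpos : ∀ᶠ δ in 𝓝 (0 : ℝ), 0 < q.eval (x - δ) * q.eval (x + δ) := by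
    apply hcont.continuousAt.eventually_const_lt
    simpa using mul_self_pos.2 hq
  filter_upwards [nhdsWithin_le_nhds hpos, self_mem_nhdsWithin] with δ h1 (h2 : 0 < δ)
  simp only [eval_mul, eval_sub, eval_X, eval_C]
  -- The product equals `-δ ^ 2 * (q (x - δ) * q (x + δ))`.
  nlinarith [mul_pos (mul_pos h2 h2) h1]

theorem exists_isRoot_of_mul_neg {p : ℝ[X]} {a b : ℝ} (hab : a < b)
    (h : p.eval a * p.eval b < 0) : ∃ x ∈ Set.Ioo a b, p.eval x = 0 := by
  have hc : ContinuousOn (fun x => p.eval x) (Set.Icc a b) := p.continuous.continuousOn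
  rcases mul_neg_iff.1 h with ⟨h1, h2⟩ | ⟨h1, h2⟩
  · exact intermediate_value_Ioo' hab.le hc ⟨h2, h1⟩
  · exact intermediate_value_Ioo hab.le hc ⟨h1, h2⟩

theorem eventually_disjoint_intervals (s : Finset ℝ) :
    ∀ᶠ δ in 𝓝[>] (0 : ℝ), ∀ x ∈ s, ∀ y ∈ s, x ≠ y → 2 * δ ≤ |x - y| := by
  rw [Finset.eventually_all]
  intro x _
  rw [Finset.eventually_all]
  intro y _
  by_cases hxy : x = y
  · simp [hxy]
  · have : (0 : ℝ) < |x - y| / 2 := by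
      have := abs_pos.2 (sub_ne_zero.2 hxy)
      positivity
    filter_upwards [nhdsWithin_le_nhds (eventually_lt_nhds this)] with δ hδ _
    linarith

/-- Having `d` distinct real roots is stable under perturbation among polynomials of degree at
most `d`. -/
theorem RealSimple.eventually {α : Type*} {l : Filter α} {R : α → ℝ[X]} {R₀ : ℝ[X]} {d : ℕ}
    (h : RealSimple R₀ d) (hd : ∀ a, (R a).natDegree ≤ d)
    (hc : ∀ i, Tendsto (fun a => (R a).coeff i) l (𝓝 (R₀.coeff i))) :
    ∀ᶠ a in l, RealSimple (R a) d := by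
  have hev := tendsto_eval_of_tendsto_coeff hd h.2.1 hc
  obtain ⟨h0, -, s, hs, hr⟩ := id h
  -- A point where the limit does not vanish keeps the perturbed polynomials nonzero.
  obtain ⟨y, hy⟩ : ∃ y, R₀.eval y ≠ 0 := by
    by_contra! hcon
    exact h0 (Polynomial.funext fun x => by simpa using hcon x)
  have hδ : ∀ᶠ δ in 𝓝[>] (0 : ℝ), ∀ x ∈ s, R₀.eval (x - δ) * R₀.eval (x + δ) < 0 := by
    rw [Finset.eventually_all]
    exact fun x hx => eventually_eval_mul_eval_neg (hr x hx)
      (h.derivative_eval_ne_zero (hr x hx))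
  obtain ⟨δ, ⟨hδ1, hδ2⟩, hδ0⟩ :=
    ((hδ.and (eventually_disjoint_intervals s)).and self_mem_nhdsWithin).exists
  replace hδ0 : 0 < δ := hδ0
  have hneg : ∀ᶠ a in l, ∀ x ∈ s, (R a).eval (x - δ) * (R a).eval (x + δ) < 0 := by
    rw [Finset.eventually_all]
    exact fun x hx => ((hev _).mul (hev _)).eventually_lt_const (hδ1 x hx)
  filter_upwards [hneg, (hev y).eventually_ne hy] with a ha hay
  refine ⟨fun h => hay (by simp [h]), hd a, ?_⟩
  have hex : ∀ x : ℝ, ∃ z, x ∈ s → z ∈ Set.Ioo (x - δ) (x + δ) ∧ (R a).eval z = 0 := by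
    intro x
    by_cases hx : x ∈ s
    · obtain ⟨z, hz⟩ := exists_isRoot_of_mul_neg (by linarith) (ha x hx)
      exact ⟨z, fun _ => hz⟩
    · exact ⟨0, fun h => absurd h hx⟩
  choose g hg using hex
  refine ⟨s.image g, ?_, ?_⟩
  · rw [Finset.card_image_of_injOn, hs]
    intro x hx y hy hxy
    by_contra hne
    have h1 := (hg x hx).1
    have h2 := (hg y hy).1
    rw [← hxy] at h2
    have h3 := hδ2 x hx y hy hne
    have h4 : |x - y| < 2 * δ := by
      rw [abs_lt]
      constructor <;> linarith [h1.1, h1.2, h2.1, h2.2]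
    linarith
  · intro z hz
    obtain ⟨x, hx, rfl⟩ := Finset.mem_image.1 hz
    exact (hg x hx).2

/-- `p = X ^ o * q` where `q` has `d - o` distinct real roots, all nonzero. -/
def NearlySimple (p : ℝ[X]) (d o : ℕ) : Prop :=
  o ≤ d ∧ p.coeff o ≠ 0 ∧ ∃ q, p = X ^ o * q ∧ RealSimple q (d - o)

theorem coeff_iterate_divX (p : ℝ[X]) (m i : ℕ) : (divX^[m] p).coeff i = p.coeff (i + m) := by
  induction m generalizing i with
  | zero => simp
  | succ m ih => rw [Function.iterate_succ_apply', coeff_divX, ih]; congr 1; omega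

theorem eq_X_pow_mul_iterate_divX {p : ℝ[X]} {m : ℕ} (h : ∀ i < m, p.coeff i = 0) :
    p = X ^ m * divX^[m] p := by
  ext i
  rw [coeff_X_pow_mul', coeff_iterate_divX]
  split_ifs with hi
  · congr 1; omega
  · exact h i (by omega)

theorem natDegree_iterate_divX_le {p : ℝ[X]} {m d : ℕ} (h : p.natDegree ≤ d) :
    (divX^[m] p).natDegree ≤ d - m := by
  rw [natDegree_le_iff_coeff_eq_zero]
  intro i hi
  rw [coeff_iterate_divX]
  exact coeff_eq_zero_of_natDegree_lt (by omega)

/-- If the order at `0` of a perturbation drops by at most one, then the perturbed polynomial has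
only simple real roots away from `0`. -/
theorem NearlySimple.eventually {α : Type*} {l : Filter α} {R : α → ℝ[X]} {R₀ : ℝ[X]}
    {d o o' : ℕ} (h : NearlySimple R₀ d o) (ho : o' ≤ o) (ho' : o ≤ o' + 1)
    (hd : ∀ a, (R a).natDegree ≤ d)
    (hc : ∀ i, Tendsto (fun a => (R a).coeff i) l (𝓝 (R₀.coeff i)))
    (hlow : ∀ᶠ a in l, ∀ i < o', (R a).coeff i = 0) (hne : ∀ᶠ a in l, (R a).coeff o' ≠ 0) :
    ∀ᶠ a in l, NearlySimple (R a) d o' := by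
  obtain ⟨hod, hco, q, hq, hqs⟩ := h
  have hq0 : q.eval 0 ≠ 0 := by
    rw [hq] at hco
    rwa [← coeff_zero_eq_eval_zero, ← coeff_X_pow_mul q o 0, zero_add]
  -- The quotient of the limit by `X ^ o'` is `q` or `X * q`; in the second case `0` is one more
  -- simple root because `q 0 ≠ 0`.
  have hbase : RealSimple (divX^[o'] R₀) (d - o') := by
    rcases (show o = o' ∨ o = o' + 1 by omega) with rfl | rfl
    · convert hqs
      ext i
      rw [coeff_iterate_divX, hq, coeff_X_pow_mul]
    · have : divX^[o'] R₀ = X * q := by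
        ext i
        rw [coeff_iterate_divX, hq, pow_succ, mul_assoc, coeff_X_pow_mul]
      rw [this]
      obtain ⟨q0, qd, s, hs, hr⟩ := hqs
      refine ⟨mul_ne_zero X_ne_zero q0, ?_, insert 0 s, ?_, ?_⟩
      · rw [natDegree_X_mul q0]; omega
      · rw [Finset.card_insert_of_notMem fun h => hq0 (hr 0 h)]; omega
      · intro x hx
        rcases Finset.mem_insert.1 hx with rfl | hx
        · simp
        · simp [hr x hx]
  have := hbase.eventually (R := fun a => divX^[o'] (R a)) (l := l)
    (fun a => natDegree_iterate_divX_le (hd a))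
    (fun i => by simpa only [coeff_iterate_divX] using hc _)
  filter_upwards [this, hlow, hne] with a h1 h2 h3
  exact ⟨by omega, h3, _, eq_X_pow_mul_iterate_divX h2, h1⟩

theorem NearlySimple.realSimple {p : ℝ[X]} {d : ℕ} (h : NearlySimple p d 0) : RealSimple p d := by
  obtain ⟨-, -, q, rfl, hq⟩ := h
  simpa using hq

end

/-! ### Cauchy–Binet and the expansion of `m_k` in powers of `t` -/

section

open Polynomial Finset

namespace Matrix

variable {R : Type*} [CommRing R] {k n : ℕ}

theorem det_mul_eq_sum_prod_mul_det (A : Matrix (Fin k) (Fin n) R) (B : Matrix (Fin n) (Fin k) R) :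
    (A * B).det = ∑ f : Fin k → Fin n, (∏ i, A i (f i)) * (B.submatrix f id).det := by
  have h : A * B = fun i => ∑ l, A i l • B l := by
    ext i j
    simp [Matrix.mul_apply]
  have := (detRowAlternating (R := R) (n := Fin k)).toMultilinearMap.map_sum
    (fun i (l : Fin n) => A i l • B l)
  rw [h]
  refine this.trans (sum_congr rfl fun f _ => ?_)
  exact (detRowAlternating (R := R) (n := Fin k)).toMultilinearMap.map_smul_univ
    (fun i => A i (f i)) (fun i => B (f i))

/-- The **Cauchy–Binet formula**. -/
theorem det_mul_eq_sum_orderEmbedding (A : Matrix (Fin k) (Fin n) R)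
    (B : Matrix (Fin n) (Fin k) R) :
    (A * B).det = ∑ f : Fin k ↪o Fin n, (A.submatrix id f).det * (B.submatrix f id).det := by
  classical
  rw [det_mul_eq_sum_prod_mul_det]
  have h1 : ∀ f : Fin k ↪o Fin n, (A.submatrix id f).det * (B.submatrix f id).det =
      ∑ σ : Equiv.Perm (Fin k), (∏ i, A i (f (σ i))) * (B.submatrix (f ∘ σ) id).det := by
    intro f
    rw [← det_transpose (A.submatrix id f), det_apply', sum_mul]
    refine sum_congr rfl fun σ _ => ?_
    have : B.submatrix (f ∘ σ) id = (B.submatrix f id).submatrix σ id := rfl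
    rw [this, det_permute]
    simp only [transpose_apply, submatrix_apply, id_eq]
    ring
  simp_rw [h1]
  rw [← sum_product', univ_product_univ]
  symm
  -- An injective row choice is uniquely an increasing one composed with a permutation; any other
  -- choice repeats a row and contributes zero.
  refine sum_of_injOn (fun p : (Fin k ↪o Fin n) × Equiv.Perm (Fin k) => p.1 ∘ p.2) ?_
    (fun _ _ => by simp) ?_ (fun _ _ => rfl)
  · rintro ⟨f, σ⟩ - ⟨g, τ⟩ - h
    have h : (f : Fin k → Fin n) ∘ σ = g ∘ τ := h
    have hr := congrArg Set.range h
    rw [EquivLike.range_comp, EquivLike.range_comp, f.strictMono.range_inj g.strictMono] at hr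
    obtain rfl : f = g := DFunLike.coe_injective hr
    have : σ = τ := Equiv.ext fun i => f.injective (congrFun h i)
    rw [this]
  · intro f _ hf
    by_cases hinj : Function.Injective f
    · exfalso
      apply hf
      have hs : StrictMono (f ∘ Tuple.sort f) :=
        (Tuple.monotone_sort f).strictMono_of_injective
          (hinj.comp (Tuple.sort f).injective)
      refine ⟨⟨OrderEmbedding.ofStrictMono _ hs, (Tuple.sort f)⁻¹⟩, by simp, ?_⟩
      ext i
      simp
    · obtain ⟨i, j, hij, hne⟩ : ∃ i j, f i = f j ∧ i ≠ j := by
        simpa [Function.Injective] using hinj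
      rw [det_zero_of_row_eq hne, mul_zero]
      ext l
      simp [hij]

/-- The `j`-th descending factorial is a monic polynomial of degree `j`, so the determinant is the
Vandermonde determinant of the increasing values `f i`. -/
theorem det_descFactorial_pos {f : Fin k → ℕ} (hf : StrictMono f) :
    0 < (of fun i j : Fin k => ((f i).descFactorial j : ℝ)).det := by
  have h := det_eval_matrixOfPolynomials_eq_det_vandermonde (fun i => (f i : ℝ))
    (fun j : Fin k => descPochhammer ℝ j) (fun i => descPochhammer_natDegree ℝ i)
    (fun i => monic_descPochhammer ℝ i)
  simp only [descPochhammer_eval_eq_descFactorial] at h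
  rw [← h, det_vandermonde]
  refine prod_pos fun i _ => prod_pos fun j hj => ?_
  rw [sub_pos, Nat.cast_lt]
  exact hf (Finset.mem_Ioi.1 hj)

end Matrix

variable {n k : ℕ}

theorem orderEmb_le (f : Fin k ↪o Fin n) (i : Fin k) : (i : ℕ) ≤ f i := by
  have hf : StrictMono fun i : Fin k => (f i : ℕ) := f.strictMono
  obtain ⟨i, hi⟩ := i
  induction i with
  | zero => simp
  | succ i ih =>
    have h1 := ih (by omega)
    have h2 := hf (show (⟨i, by omega⟩ : Fin k) < ⟨i + 1, hi⟩ by simp [Fin.lt_def])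
    simp only at h1 h2 ⊢
    omega

theorem orderEmb_le' (f : Fin k ↪o Fin n) (i : Fin k) : (f i : ℕ) ≤ n - k + i := by
  have hf : StrictMono fun i : Fin k => (f i : ℕ) := f.strictMono
  obtain ⟨m, hm⟩ : ∃ m, m = k - 1 - i := ⟨_, rfl⟩
  have key : (f i : ℕ) + (k - i) ≤ n := by
    induction m generalizing i with
    | zero => have := (f i).2; have := i.2; omega
    | succ m ih =>
      have h1 := ih ⟨i + 1, by omega⟩ (by simp only; omega)
      have h2 := hf (show i < (⟨i + 1, by omega⟩ : Fin k) by simp [Fin.lt_def])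
      simp only at h1 h2
      omega
  omega

/-- The codimension of the Schubert cell given by the columns `f`. -/
def codeg (f : Fin k ↪o Fin n) : ℕ := ∑ i, ((f i : ℕ) - i)

theorem codeg_add (f : Fin k ↪o Fin n) : codeg f + ∑ i : Fin k, (i : ℕ) = ∑ i, (f i : ℕ) := by
  rw [codeg, ← sum_add_distrib]
  exact sum_congr rfl fun i _ => Nat.sub_add_cancel (orderEmb_le f i)

theorem codeg_le (f : Fin k ↪o Fin n) : codeg f ≤ k * (n - k) := by
  have : codeg f ≤ ∑ _i : Fin k, (n - k) := sum_le_sum fun i _ => by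
    have := orderEmb_le' f i; omega
  simpa using this

/-- Scaling column `j` by `X ^ j` leaves a common factor `X ^ f i` in row `i`. Where `f i - j` is
truncated, the descending factorial vanishes. -/
theorem det_descFactorial_X_pow (f : Fin k ↪o Fin n) :
    (Matrix.of fun i j : Fin k =>
      C ((f i : ℕ).descFactorial j : ℝ) * X ^ ((f i : ℕ) - j)).det =
    C (Matrix.of fun i j : Fin k => ((f i : ℕ).descFactorial j : ℝ)).det * X ^ codeg f := by
  have hX : (X : ℝ[X]) ^ (∑ i : Fin k, (i : ℕ)) ≠ 0 := pow_ne_zero _ X_ne_zero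
  apply mul_left_cancel₀ hX
  rw [mul_left_comm, ← pow_add, add_comm, codeg_add, RingHom.map_det, ← prod_pow_eq_pow_sum,
    ← prod_pow_eq_pow_sum, ← Matrix.det_mul_row, mul_comm, ← Matrix.det_mul_column]
  congr 1
  ext1 i j
  simp only [Matrix.of_apply, RingHom.mapMatrix_apply, Matrix.map_apply]
  by_cases h : (j : ℕ) ≤ f i
  · rw [mul_left_comm, ← pow_add, Nat.add_sub_cancel' h, mul_comm]
  · rw [Nat.descFactorial_of_lt (by omega)]
    simp

/-- The products of the first subdiagonal entries. -/
noncomputable def subdiagProd (N : Matrix (Fin n) (Fin n) ℝ) (i : ℕ) : ℝ :=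
  ∏ l ∈ range i, if h : l + 1 < n then N ⟨l + 1, h⟩ ⟨l, by omega⟩ else 1

variable {N : Matrix (Fin n) (Fin n) ℝ}

theorem subdiagProd_pos (hN : N ∈ posSubdiagonal n) (i : ℕ) : 0 < subdiagProd N i := by
  refine prod_pos fun l _ => ?_
  split_ifs with h
  · exact (hN _ _).1 rfl
  · exact one_pos

/-- This exhibits `N` as the standard shift conjugated by a diagonal matrix, so that its powers
telescope. -/
theorem apply_eq_subdiagProd_div (hN : N ∈ posSubdiagonal n) (i j : Fin n) :
    N i j = if (i : ℕ) = j + 1 then subdiagProd N i / subdiagProd N j else 0 := by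
  split_ifs with h
  · rw [eq_div_iff (subdiagProd_pos hN _).ne', h, subdiagProd, subdiagProd, prod_range_succ,
      dif_pos (h ▸ i.2), mul_comm]
    congr 2
    exact Fin.ext h
  · exact (hN i j).2 h

theorem pow_apply_eq_subdiagProd_div (hN : N ∈ posSubdiagonal n) (m : ℕ) (i j : Fin n) :
    (N ^ m) i j = if (i : ℕ) = j + m then subdiagProd N i / subdiagProd N j else 0 := by
  induction m generalizing i with
  | zero =>
    rw [pow_zero, Matrix.one_apply]
    by_cases h : i = j
    · simp [h, div_self (subdiagProd_pos hN _).ne']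
    · simp [h, Fin.val_inj]
  | succ m ih =>
    rw [pow_succ', Matrix.mul_apply]
    simp_rw [ih, apply_eq_subdiagProd_div hN i]
    split_ifs with h
    · rw [sum_eq_single ⟨j + m, by omega⟩]
      · rw [if_pos (by simp only; omega), if_pos rfl]
        have := (subdiagProd_pos hN (j + m)).ne'
        field_simp
      · intro l _ hl
        rw [if_neg (fun h' => hl ?_), zero_mul]
        ext; simp only; omega
      · simp
    · refine sum_eq_zero fun l _ => ?_
      split_ifs
      · omega
      all_goals simp

/-- Since `1 / (i - j)!` is the descending factorial over `i!`, each entry splits into a column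
factor, a row factor and an entry of the matrix in `det_descFactorial_X_pow`. -/
theorem exp_smul_apply (hN : N ∈ posSubdiagonal n) (t : ℝ) (i j : Fin n) :
    NormedSpace.exp (t • N) i j = (subdiagProd N j)⁻¹ * (subdiagProd N i / (i : ℕ).factorial *
      ((i : ℕ).descFactorial j * t ^ ((i : ℕ) - j))) := by
  have hpow : ∀ m, n ≤ m → N ^ m = 0 := by
    intro m hm
    ext i j
    rw [pow_apply_eq_subdiagProd_div hN, if_neg (by omega), Matrix.zero_apply]
  rw [NormedSpace.exp_eq_tsum ℝ]
  simp only
  rw [tsum_eq_sum (s := range n) fun m hm => by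
    rw [_root_.smul_pow, hpow m (by simpa using hm), smul_zero, smul_zero]]
  rw [Matrix.sum_apply]
  simp only [_root_.smul_pow, Matrix.smul_apply, pow_apply_eq_subdiagProd_div hN, smul_eq_mul]
  by_cases h : (j : ℕ) ≤ i
  · rw [sum_eq_single ((i : ℕ) - j)]
    · rw [if_pos (by omega)]
      have h1 : ((((i : ℕ) - j).factorial : ℝ)) * ((i : ℕ).descFactorial j) =
          (i : ℕ).factorial := by
        exact_mod_cast Nat.factorial_mul_descFactorial h
      have h2 : ((((i : ℕ) - j).factorial : ℝ)) ≠ 0 := by positivity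
      have h3 : (((i : ℕ).factorial : ℝ)) ≠ 0 := by positivity
      have h4 := (subdiagProd_pos hN j).ne'
      field_simp
      rw [← h1]
      ring
    · intro m _ hm
      rw [if_neg (by omega), mul_zero, mul_zero]
    · intro h'
      simp only [mem_range] at h'
      omega
  · rw [Nat.descFactorial_of_lt (by omega)]
    simp only [Nat.cast_zero, zero_mul, mul_zero]
    refine sum_eq_zero fun m _ => ?_
    rw [if_neg (by omega), mul_zero, mul_zero]

/-- The `i`-th of the last `k` rows. -/
def lastRow (hk : k ≤ n) (i : Fin k) : Fin n := ⟨n - k + i, by omega⟩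

theorem strictMono_lastRow (hk : k ≤ n) : StrictMono (lastRow hk) := fun i j hij => by
  rw [Fin.lt_def] at hij ⊢
  simp only [lastRow]
  omega

/-- The minor of `L` with the last `k` rows and the columns `f`. -/
noncomputable def lowMinor (hk : k ≤ n) (L : Matrix (Fin n) (Fin n) ℝ) (f : Fin k → Fin n) : ℝ :=
  (L.submatrix (lastRow hk) f).det

theorem exists_weights (hN : N ∈ posSubdiagonal n) (hk : k ≤ n) :
    ∃ w : (Fin k ↪o Fin n) → ℝ, (∀ f, 0 < w f) ∧ ∀ L t, mFun (polyCurve N L) k hk t =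
      ∑ f : Fin k ↪o Fin n, lowMinor hk L f * w f * t ^ codeg f := by
  refine ⟨fun f => (∏ j : Fin k, (subdiagProd N j)⁻¹) *
    ((∏ i, subdiagProd N (f i) / (f i : ℕ).factorial) *
      (Matrix.of fun i j : Fin k => ((f i : ℕ).descFactorial j : ℝ)).det), ?_, ?_⟩
  · intro f
    have h0 := subdiagProd_pos hN
    refine mul_pos (prod_pos fun j _ => inv_pos.2 (h0 _)) (mul_pos (prod_pos fun i _ =>
      div_pos (h0 _) (by positivity)) (Matrix.det_descFactorial_pos (f := fun i => (f i : ℕ)) f.strictMono))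
  · intro L t
    have h1 : swminor (polyCurve N L t) k hk = (L.submatrix (lastRow hk) id) *
        ((NormedSpace.exp (t • N)).submatrix id (Fin.castLE hk)) := by
      rw [polyCurve, swminor, ← Matrix.submatrix_mul _ _ _ _ _ Function.bijective_id]
      rfl
    rw [mFun, h1, Matrix.det_mul_eq_sum_orderEmbedding]
    refine sum_congr rfl fun f _ => ?_
    rw [Matrix.submatrix_submatrix, mul_assoc]
    refine congrArg₂ (· * ·) rfl ?_
    have h2 : ((NormedSpace.exp (t • N)).submatrix id (Fin.castLE hk)).submatrix f id =
        Matrix.of fun i j : Fin k => (subdiagProd N j)⁻¹ *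
          (Matrix.of fun i j : Fin k => subdiagProd N (f i) / (f i : ℕ).factorial *
            ((evalRingHom t).mapMatrix (Matrix.of fun i j : Fin k =>
      C ((f i : ℕ).descFactorial j : ℝ) * X ^ ((f i : ℕ) - j))) i j) i j := by
      ext i j
      simp [exp_smul_apply hN]
    rw [h2, Matrix.det_mul_row, Matrix.det_mul_column, ← RingHom.map_det, det_descFactorial_X_pow]
    simp
    ring

/-- The polynomial with coefficients given by the minors of `L` and the weights `w`. -/
noncomputable def minorPoly (hk : k ≤ n) (w : (Fin k ↪o Fin n) → ℝ)
    (L : Matrix (Fin n) (Fin n) ℝ) : ℝ[X] :=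
  ∑ f : Fin k ↪o Fin n, C (lowMinor hk L f * w f) * X ^ codeg f

theorem minorPoly_coeff (hk : k ≤ n) (w : (Fin k ↪o Fin n) → ℝ) (L : Matrix (Fin n) (Fin n) ℝ)
    (d : ℕ) : (minorPoly hk w L).coeff d =
      ∑ f : Fin k ↪o Fin n, if d = codeg f then lowMinor hk L f * w f else 0 := by
  simp only [minorPoly, finsetSum_coeff, coeff_C_mul, coeff_X_pow, mul_ite, mul_one, mul_zero]

theorem minorPoly_eval (hk : k ≤ n) (w : (Fin k ↪o Fin n) → ℝ) (L : Matrix (Fin n) (Fin n) ℝ)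
    (t : ℝ) : (minorPoly hk w L).eval t =
      ∑ f : Fin k ↪o Fin n, lowMinor hk L f * w f * t ^ codeg f := by
  simp [minorPoly, eval_finsetSum]

theorem minorPoly_natDegree_le (hk : k ≤ n) (w : (Fin k ↪o Fin n) → ℝ)
    (L : Matrix (Fin n) (Fin n) ℝ) : (minorPoly hk w L).natDegree ≤ k * (n - k) := by
  refine natDegree_sum_le_of_forall_le _ _ fun f _ => ?_
  exact (natDegree_C_mul_X_pow_le _ _).trans (codeg_le f)

end

/-! ### Column deformations of the identity: real simple roots -/

section

open Polynomial Finset Filter Topology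

variable {n k : ℕ}

theorem lowMinor_eq_zero_of_not_injective (hk : k ≤ n) (L : Matrix (Fin n) (Fin n) ℝ)
    {f : Fin k → Fin n} {i j : Fin k} (hij : i ≠ j) (h : f i = f j) : lowMinor hk L f = 0 :=
  Matrix.det_zero_of_column_eq hij fun l => by simp [h]

theorem strictMono_update (f : Fin k ↪o Fin n) (i : Fin k) (u : Fin n)
    (hu : (u : ℕ) = f i + 1 ∨ (f i : ℕ) = u + 1) (hf : ∀ j, f j ≠ u) :
    StrictMono (Function.update f i u) := by
  intro a b hab
  have h1 : (f a : ℕ) < f b := f.strictMono hab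
  have h2 : ∀ j, (f j : ℕ) ≠ u := fun j h => hf j (Fin.ext h)
  rw [Fin.lt_def]
  by_cases ha : a = i
  · subst ha
    rw [Function.update_self, Function.update_of_ne hab.ne']
    have := h2 b
    omega
  · by_cases hb : b = i
    · subst hb
      rw [Function.update_self, Function.update_of_ne hab.ne]
      have := h2 a
      omega
    · rwa [Function.update_of_ne ha, Function.update_of_ne hb]

theorem codeg_update (f g : Fin k ↪o Fin n) (i : Fin k) (u : Fin n)
    (hg : (g : Fin k → Fin n) = Function.update f i u) : codeg g + f i = codeg f + u := by
  have hf' := codeg_add f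
  have hg' := codeg_add g
  rw [← add_sum_erase (a := i) _ (fun x => ((f x : Fin n) : ℕ)) (mem_univ i)] at hf'
  rw [← add_sum_erase (a := i) _ (fun x => ((g x : Fin n) : ℕ)) (mem_univ i)] at hg'
  have h1 : (g i : ℕ) = u := by rw [hg, Function.update_self]
  have h2 : ∑ x ∈ univ.erase i, (g x : ℕ) = ∑ x ∈ univ.erase i, (f x : ℕ) :=
    sum_congr rfl fun x hx => by rw [hg, Function.update_of_ne (ne_of_mem_erase hx)]
  rw [h1, h2] at hg'
  omega

/-- `ε` times the column `v₁` is added to the column `v₀`. -/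
def addColumn (L : Matrix (Fin n) (Fin n) ℝ) (v₀ v₁ : Fin n) (ε : ℝ) : Matrix (Fin n) (Fin n) ℝ :=
  L.updateCol v₀ fun i => L i v₀ + ε * L i v₁

theorem addColumn_mem_Lo1 {L : Matrix (Fin n) (Fin n) ℝ} (hL : L ∈ Lo1 n) {v₀ v₁ : Fin n}
    (hv : v₀ < v₁) (ε : ℝ) : addColumn L v₀ v₁ ε ∈ Lo1 n := by
  refine ⟨fun i => ?_, fun i j hij => ?_⟩
  · rw [addColumn, Matrix.updateCol_apply]
    split_ifs with h
    · subst h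
      rw [hL.1, hL.2 _ _ hv, mul_zero, add_zero]
    · exact hL.1 i
  · rw [addColumn, Matrix.updateCol_apply]
    split_ifs with h
    · subst h
      rw [hL.2 _ _ hij, hL.2 _ _ (hij.trans hv), mul_zero, add_zero]
    · exact hL.2 _ _ hij

/-- The derivative of `lowMinor hk (addColumn L v₀ v₁ ε) f` with respect to `ε`. -/
noncomputable def shiftMinor (hk : k ≤ n) (L : Matrix (Fin n) (Fin n) ℝ) (v₀ v₁ : Fin n)
    (f : Fin k ↪o Fin n) : ℝ :=
  ∑ i, if f i = v₀ then lowMinor hk L (Function.update f i v₁) else 0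

theorem shiftMinor_eq (hk : k ≤ n) (L : Matrix (Fin n) (Fin n) ℝ) (v₁ : Fin n)
    (f : Fin k ↪o Fin n) (i : Fin k) :
    shiftMinor hk L (f i) v₁ f = lowMinor hk L (Function.update f i v₁) := by
  simp [shiftMinor]

theorem lowMinor_addColumn (hk : k ≤ n) (L : Matrix (Fin n) (Fin n) ℝ) (v₀ v₁ : Fin n) (ε : ℝ)
    (f : Fin k ↪o Fin n) : lowMinor hk (addColumn L v₀ v₁ ε) f =
      lowMinor hk L f + ε * shiftMinor hk L v₀ v₁ f := by
  by_cases h : ∃ i, f i = v₀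
  · obtain ⟨i, rfl⟩ := h
    have h1 : (addColumn L (f i) v₁ ε).submatrix (lastRow hk) f =
        (L.submatrix (lastRow hk) f).updateCol i
          ((fun a => L (lastRow hk a) (f i)) + ε • fun a => L (lastRow hk a) v₁) := by
      ext a b
      by_cases hb : b = i
      · subst hb; simp [addColumn]
      · simp [addColumn, hb]
    have h2 : (L.submatrix (lastRow hk) f).updateCol i (fun a => L (lastRow hk a) (f i)) =
        L.submatrix (lastRow hk) f := by
      ext a b
      by_cases hb : b = i
      · subst hb; simp
      · simp [hb]
    have h3 : (L.submatrix (lastRow hk) f).updateCol i (fun a => L (lastRow hk a) v₁) =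
        L.submatrix (lastRow hk) (Function.update f i v₁) := by
      ext a b
      by_cases hb : b = i
      · subst hb; simp
      · simp [hb]
    rw [shiftMinor_eq, lowMinor, h1, Matrix.det_updateCol_add, Matrix.det_updateCol_smul, h2, h3]
    rfl
  · push Not at h
    have h1 : (addColumn L v₀ v₁ ε).submatrix (lastRow hk) f = L.submatrix (lastRow hk) f := by
      ext a b
      simp [addColumn, h b]
    simp [lowMinor, shiftMinor, h1, h]

/-- Because the two columns are adjacent, replacing one by the other either repeats a column or
keeps the columns in increasing order, so no sign appears. -/
theorem shiftMinor_eq_zero_or (hk : k ≤ n) (L : Matrix (Fin n) (Fin n) ℝ) {v₀ v₁ : Fin n}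
    (hv : (v₁ : ℕ) = v₀ + 1) (f : Fin k ↪o Fin n) : shiftMinor hk L v₀ v₁ f = 0 ∨
      ∃ g : Fin k ↪o Fin n, shiftMinor hk L v₀ v₁ f = lowMinor hk L g ∧
        codeg g = codeg f + 1 := by
  by_cases h : ∃ i, f i = v₀
  · obtain ⟨i, rfl⟩ := h
    rw [shiftMinor_eq]
    by_cases h1 : ∃ j, f j = v₁
    · obtain ⟨j, rfl⟩ := h1
      left
      have hij : i ≠ j := by rintro rfl; omega
      refine lowMinor_eq_zero_of_not_injective hk L hij ?_
      simp [hij.symm]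
    · push Not at h1
      right
      refine ⟨OrderEmbedding.ofStrictMono _ (strictMono_update f i v₁ (Or.inl hv) h1), rfl, ?_⟩
      have := codeg_update f (OrderEmbedding.ofStrictMono _
        (strictMono_update f i v₁ (Or.inl hv) h1)) i v₁ rfl
      omega
  · push Not at h
    left
    simp [shiftMinor, h]

/-- The derivative of the coefficients of `minorPoly` under `addColumn`. -/
noncomputable def shiftCoeff (hk : k ≤ n) (w : (Fin k ↪o Fin n) → ℝ)
    (L : Matrix (Fin n) (Fin n) ℝ) (v₀ v₁ : Fin n) (d : ℕ) : ℝ :=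
  ∑ f : Fin k ↪o Fin n, if d = codeg f then shiftMinor hk L v₀ v₁ f * w f else 0

theorem minorPoly_addColumn_coeff (hk : k ≤ n) (w : (Fin k ↪o Fin n) → ℝ)
    (L : Matrix (Fin n) (Fin n) ℝ) (v₀ v₁ : Fin n) (ε : ℝ) (d : ℕ) :
    (minorPoly hk w (addColumn L v₀ v₁ ε)).coeff d =
      (minorPoly hk w L).coeff d + ε * shiftCoeff hk w L v₀ v₁ d := by
  rw [minorPoly_coeff, minorPoly_coeff, shiftCoeff, mul_sum, ← sum_add_distrib]
  refine sum_congr rfl fun f _ => ?_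
  split_ifs
  · rw [lowMinor_addColumn]; ring
  · ring

section Nonneg

variable {hk : k ≤ n} {w : (Fin k ↪o Fin n) → ℝ} (hw : ∀ f, 0 < w f)
  {L : Matrix (Fin n) (Fin n) ℝ} (hL : ∀ f : Fin k ↪o Fin n, 0 ≤ lowMinor hk L f)
  {v₀ v₁ : Fin n} (hv : (v₁ : ℕ) = v₀ + 1)

include hw hL

theorem minorPoly_coeff_nonneg (d : ℕ) : 0 ≤ (minorPoly hk w L).coeff d := by
  rw [minorPoly_coeff]
  refine sum_nonneg fun f _ => ?_
  split_ifs
  · exact mul_nonneg (hL f) (hw f).le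
  · exact le_rfl

theorem minorPoly_coeff_ne_zero_iff (d : ℕ) : (minorPoly hk w L).coeff d ≠ 0 ↔
    ∃ f : Fin k ↪o Fin n, codeg f = d ∧ lowMinor hk L f ≠ 0 := by
  rw [minorPoly_coeff, Ne, sum_eq_zero_iff_of_nonneg]
  · push Not
    refine exists_congr fun f => ?_
    have := (hw f).ne'
    by_cases h : codeg f = d <;> simp [h, this, eq_comm]
    intro h'
    exact absurd h'.symm h
  · intro f _
    split_ifs
    · exact mul_nonneg (hL f) (hw f).le
    · exact le_rfl

omit hw in
include hv in
theorem shiftMinor_nonneg (f : Fin k ↪o Fin n) : 0 ≤ shiftMinor hk L v₀ v₁ f := by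
  rcases shiftMinor_eq_zero_or hk L hv f with h | ⟨g, h, -⟩
  · exact h.ge
  · exact h ▸ hL g

include hv

theorem shiftCoeff_nonneg (d : ℕ) : 0 ≤ shiftCoeff hk w L v₀ v₁ d := by
  refine sum_nonneg fun f _ => ?_
  split_ifs
  · exact mul_nonneg (shiftMinor_nonneg hL hv f) (hw f).le
  · exact le_rfl

theorem shiftCoeff_ne_zero_iff (d : ℕ) : shiftCoeff hk w L v₀ v₁ d ≠ 0 ↔
    ∃ f : Fin k ↪o Fin n, codeg f = d ∧ shiftMinor hk L v₀ v₁ f ≠ 0 := by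
  rw [shiftCoeff, Ne, sum_eq_zero_iff_of_nonneg]
  · push Not
    refine exists_congr fun f => ?_
    have := (hw f).ne'
    by_cases h : codeg f = d <;> simp [h, this, eq_comm]
    intro h'
    exact absurd h'.symm h
  · intro f _
    split_ifs
    · exact mul_nonneg (shiftMinor_nonneg hL hv f) (hw f).le
    · exact le_rfl

/-- This is why the order at `0` drops by at most one: a minor entering degree `d` already
contributes to degree `d + 1`. -/
theorem minorPoly_coeff_succ_ne_zero {d : ℕ} (h : shiftCoeff hk w L v₀ v₁ d ≠ 0) :
    (minorPoly hk w L).coeff (d + 1) ≠ 0 := by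
  obtain ⟨f, rfl, hf⟩ := (shiftCoeff_ne_zero_iff hw hL hv d).1 h
  rcases shiftMinor_eq_zero_or hk L hv f with h | ⟨g, hg, hgf⟩
  · exact absurd h hf
  · exact (minorPoly_coeff_ne_zero_iff hw hL _).2 ⟨g, hgf, hg ▸ hf⟩

end Nonneg

/-- Take the least `i` with `g i > i`. The earlier values are `g j = j < i`, so column `g i - 1` is
free. -/
theorem exists_movable (g : Fin k ↪o Fin n) (hg : 0 < codeg g) :
    ∃ (i : Fin k) (u : Fin n), (g i : ℕ) = u + 1 ∧ ∀ j, g j ≠ u := by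
  have hex : ∃ i : Fin k, (i : ℕ) < g i := by
    by_contra! h
    rw [codeg, sum_eq_zero fun i _ => Nat.sub_eq_zero_of_le (h i)] at hg
    exact lt_irrefl _ hg
  obtain ⟨i, hi, hmin⟩ : ∃ i : Fin k, (i : ℕ) < g i ∧ ∀ j < i, ¬ (j : ℕ) < g j := by
    have hwf := wellFounded_lt (α := Fin k)
    exact ⟨hwf.min {i | (i : ℕ) < g i} hex, hwf.min_mem _ hex,
      fun j hj h => hwf.not_lt_min {i | (i : ℕ) < g i} h hj⟩
  refine ⟨i, ⟨g i - 1, by omega⟩, by simp only; omega, fun j hj => ?_⟩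
  have h1 : (g j : ℕ) = g i - 1 := congrArg Fin.val hj
  have h2 : j < i := g.lt_iff_lt.1 (Fin.lt_def.2 (by omega))
  have h3 := hmin j h2
  rw [Fin.lt_def] at h2
  omega

/-- A totally nonnegative stage of the deformation of the identity matrix: the polynomials have
only simple real roots, except that the root `0` has multiplicity `o k`. -/
structure IsStage (w : ∀ k : Fin n, (Fin k ↪o Fin n) → ℝ) (L : Matrix (Fin n) (Fin n) ℝ)
    (o : Fin n → ℕ) : Prop where
  mem : L ∈ Lo1 n
  nonneg : ∀ (k : Fin n) (f : Fin k ↪o Fin n), 0 ≤ lowMinor k.2.le L f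
  near : ∀ k : Fin n, NearlySimple (minorPoly k.2.le (w k) L) (k * (n - k)) (o k)

section Stage

variable {w : ∀ k : Fin n, (Fin k ↪o Fin n) → ℝ}

theorem lowMinor_one (hk : k ≤ n) (f : Fin k ↪o Fin n) :
    lowMinor hk 1 f = if (f : Fin k → Fin n) = lastRow hk then 1 else 0 := by
  split_ifs with h
  · rw [lowMinor, h, Matrix.submatrix_one _ (strictMono_lastRow hk).injective, Matrix.det_one]
  · have hex : ∃ i, ∀ j, f j ≠ lastRow hk i := by
      by_contra! hall
      apply h
      have hmono := strictMono_lastRow hk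
      have hsub : Set.range (lastRow hk) ⊆ Set.range f := by
        rintro _ ⟨i, rfl⟩
        exact hall i
      rw [← f.strictMono.range_inj hmono]
      refine (Set.eq_of_subset_of_ncard_le hsub ?_).symm
      rw [Set.ncard_range_of_injective f.injective,
        Set.ncard_range_of_injective hmono.injective]
    obtain ⟨i, hi⟩ := hex
    refine Matrix.det_eq_zero_of_row_eq_zero i fun j => ?_
    rw [Matrix.submatrix_apply, Matrix.one_apply_ne (hi j).symm]

/-- For the identity only the last `k` columns give a nonzero minor, so each polynomial is a
monomial of top degree. -/
theorem isStage_one (hw : ∀ k f, 0 < w k f) :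
    IsStage w (1 : Matrix (Fin n) (Fin n) ℝ) (fun k => k * (n - k)) := by
  refine ⟨⟨fun i => Matrix.one_apply_eq i, fun i j hij => Matrix.one_apply_ne hij.ne⟩, ?_, ?_⟩
  · intro k f
    rw [lowMinor_one]
    split_ifs <;> simp
  · intro k
    have hmono := strictMono_lastRow k.2.le
    set g : Fin k ↪o Fin n := OrderEmbedding.ofStrictMono _ hmono with hg
    have hcodeg : codeg g = k * (n - k) := by
      simp [codeg, hg, lastRow]
    have hp : minorPoly k.2.le (w k) (1 : Matrix (Fin n) (Fin n) ℝ) =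
        X ^ ((k : ℕ) * (n - k)) * C (w k g) := by
      rw [minorPoly, sum_eq_single g]
      · have h1 := lowMinor_one k.2.le g
        rw [if_pos (show (g : Fin k → Fin n) = lastRow k.2.le from rfl)] at h1
        rw [h1, one_mul, hcodeg, mul_comm]
      · intro f _ hf
        rw [lowMinor_one, if_neg fun h => hf (DFunLike.coe_injective (h.trans rfl))]
        simp
      · simp
    have hne := (hw k g).ne'
    refine ⟨le_rfl, ?_, _, hp, ?_, ?_, ∅, ?_, ?_⟩
    · rw [hp]
      simpa using hne
    · simpa using hne
    · simp
    · simp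
    · simp

theorem NearlySimple.coeff_eq_zero {p : ℝ[X]} {d o i : ℕ} (h : NearlySimple p d o) (hi : i < o) :
    p.coeff i = 0 := by
  obtain ⟨-, -, q, rfl, -⟩ := h
  rw [coeff_X_pow_mul', if_neg (by omega)]

theorem IsStage.exists_lt (hw : ∀ k f, 0 < w k f) {L : Matrix (Fin n) (Fin n) ℝ} {o : Fin n → ℕ}
    (h : IsStage w L o) (ho : 0 < ∑ k, o k) :
    ∃ L' o', IsStage w L' o' ∧ ∑ k, o' k < ∑ k, o k := by
  obtain ⟨k₀, hk₀⟩ : ∃ k, 0 < o k := by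
    by_contra! hcon
    rw [sum_eq_zero fun k _ => Nat.le_zero.1 (hcon k)] at ho
    exact lt_irrefl _ ho
  obtain ⟨g, hgc, hg⟩ := (minorPoly_coeff_ne_zero_iff (hw k₀) (h.nonneg k₀) (o k₀)).1
    (h.near k₀).2.1
  obtain ⟨i, v₀, hi, hv₀⟩ := exists_movable g (hgc ▸ hk₀)
  set v₁ := g i with hv₁
  -- Moving `g i` one column left lowers the codegree by one, and the derivative of the resulting
  -- minor is the nonzero minor of `g`.
  have hshift : shiftCoeff k₀.2.le (w k₀) L v₀ v₁ (o k₀ - 1) ≠ 0 := by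
    have hm := strictMono_update g i v₀ (Or.inr hi) hv₀
    have hc := codeg_update g (OrderEmbedding.ofStrictMono _ hm) i v₀ rfl
    refine (shiftCoeff_ne_zero_iff (hw k₀) (h.nonneg k₀) hi _).2
      ⟨OrderEmbedding.ofStrictMono _ hm, by omega, ?_⟩
    have h1 := shiftMinor_eq k₀.2.le L v₁ (OrderEmbedding.ofStrictMono _ hm) i
    simp only [OrderEmbedding.coe_ofStrictMono, Function.update_self, Function.update_idem] at h1
    rw [h1, hv₁, Function.update_eq_self]
    exact hg
  set o' : Fin n → ℕ := fun k =>
    if 0 < o k ∧ shiftCoeff k.2.le (w k) L v₀ v₁ (o k - 1) ≠ 0 then o k - 1 else o k with ho'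
  have hnear : ∀ k : Fin n, ∀ᶠ ε in 𝓝[>] (0 : ℝ),
      NearlySimple (minorPoly k.2.le (w k) (addColumn L v₀ v₁ ε)) (k * (n - k)) (o' k) := by
    intro k
    refine (h.near k).eventually ?_ ?_ (fun _ => minorPoly_natDegree_le _ _ _) ?_ ?_ ?_
    · simp only [ho']; split_ifs <;> omega
    · simp only [ho']; split_ifs <;> omega
    · intro d
      simp only [minorPoly_addColumn_coeff]
      have : Tendsto (fun ε : ℝ => (minorPoly k.2.le (w k) L).coeff d +
          ε * shiftCoeff k.2.le (w k) L v₀ v₁ d) (𝓝 0) (𝓝 ((minorPoly k.2.le (w k) L).coeff d +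
          0 * shiftCoeff k.2.le (w k) L v₀ v₁ d)) := by
        apply Continuous.tendsto
        fun_prop
      rw [zero_mul, add_zero] at this
      exact this.mono_left nhdsWithin_le_nhds
    -- A nonzero coefficient in degree `d < o k` forces `d + 1 = o k`, and then `o' k = d`.
    · refine Eventually.of_forall fun ε d hd => ?_
      have hdo : d < o k := by
        simp only [ho'] at hd
        split_ifs at hd <;> omega
      rw [minorPoly_addColumn_coeff, (h.near k).coeff_eq_zero hdo, zero_add]
      by_contra hne
      have hne' := right_ne_zero_of_mul hne
      have h2 := minorPoly_coeff_succ_ne_zero (hw k) (h.nonneg k) hi hne'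
      have h3 : ¬ d + 1 < o k := fun hlt => h2 ((h.near k).coeff_eq_zero hlt)
      have h4 : o k - 1 = d := by omega
      simp only [ho', h4] at hd
      rw [if_pos ⟨by omega, hne'⟩] at hd
      omega
    · filter_upwards [self_mem_nhdsWithin] with ε (hε : 0 < ε)
      rw [minorPoly_addColumn_coeff]
      by_cases hc : 0 < o k ∧ shiftCoeff k.2.le (w k) L v₀ v₁ (o k - 1) ≠ 0
      · simp only [ho', if_pos hc]
        rw [(h.near k).coeff_eq_zero (by omega), zero_add]
        exact mul_ne_zero hε.ne' hc.2
      · simp only [ho', if_neg hc]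
        -- If the order does not drop, a nonnegative change cannot cancel the positive lowest
        -- coefficient.
        have h1 := (minorPoly_coeff_nonneg (hw k) (h.nonneg k) (o k)).lt_of_ne'
          (h.near k).2.1
        have h2 := mul_nonneg hε.le (shiftCoeff_nonneg (hw k) (h.nonneg k) hi (o k))
        exact (add_pos_of_pos_of_nonneg h1 h2).ne'
  obtain ⟨ε, hε, hε0⟩ := ((eventually_all.2 hnear).and self_mem_nhdsWithin).exists
  replace hε0 : 0 < ε := hε0
  refine ⟨addColumn L v₀ v₁ ε, o',
    ⟨addColumn_mem_Lo1 h.mem (Fin.lt_def.2 (by omega)) ε, ?_, hε⟩, ?_⟩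
  · intro k f
    rw [lowMinor_addColumn]
    exact add_nonneg (h.nonneg k f) (mul_nonneg hε0.le (shiftMinor_nonneg (h.nonneg k) hi f))
  · refine sum_lt_sum (fun k _ => ?_) ⟨k₀, mem_univ _, ?_⟩
    · simp only [ho']; split_ifs <;> omega
    · simp only [ho']
      rw [if_pos ⟨hk₀, hshift⟩]
      omega

theorem IsStage.exists_realSimple (hw : ∀ k f, 0 < w k f) {L : Matrix (Fin n) (Fin n) ℝ}
    {o : Fin n → ℕ} (h : IsStage w L o) :
    ∃ L' ∈ Lo1 n, ∀ k : Fin n, RealSimple (minorPoly k.2.le (w k) L') (k * (n - k)) := by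
  obtain ⟨m, hm⟩ : ∃ m, ∑ k, o k = m := ⟨_, rfl⟩
  induction m using Nat.strong_induction_on generalizing L o with
  | _ m ih =>
    rcases Nat.eq_zero_or_pos (∑ k, o k) with h0 | hpos
    · refine ⟨L, h.mem, fun k => NearlySimple.realSimple ?_⟩
      have := h.near k
      rwa [sum_eq_zero_iff.1 h0 k (mem_univ k)] at this
    · obtain ⟨L', o', h', hlt⟩ := h.exists_lt hw hpos
      exact ih _ (hm ▸ hlt) h' rfl

theorem exists_realSimple (hw : ∀ k f, 0 < w k f) :
    ∃ L ∈ Lo1 n, ∀ k : Fin n, RealSimple (minorPoly k.2.le (w k) L) (k * (n - k)) :=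
  (isStage_one hw).exists_realSimple hw

end Stage

end

/-! ### Row perturbations: no common roots -/

section

open Polynomial Finset Filter Topology

variable {n : ℕ}

/-- The determinant as a linear function of the first row. -/
noncomputable def firstRowDet {m : ℕ} (M : Matrix (Fin (m + 1)) (Fin (m + 1)) ℝ) :
    (Fin (m + 1) → ℝ) →ₗ[ℝ] ℝ :=
  (Matrix.detRowAlternating (R := ℝ) (n := Fin (m + 1))).toMultilinearMap.toLinearMap M 0

theorem firstRowDet_apply {m : ℕ} (M : Matrix (Fin (m + 1)) (Fin (m + 1)) ℝ)
    (u : Fin (m + 1) → ℝ) : firstRowDet M u = (M.updateRow 0 u).det := rfl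

/-- Such a minor omits one column `j`; up to sign it is the value of `firstRowDet M` at the `j`-th
basis vector. -/
theorem det_submatrix_succ_eq_zero {m : ℕ} {M : Matrix (Fin (m + 1)) (Fin (m + 1)) ℝ}
    (hM : ∀ u, firstRowDet M u = 0) (h : Fin m ↪o Fin (m + 1)) :
    (M.submatrix Fin.succ h).det = 0 := by
  obtain ⟨j, hj⟩ : ∃ j, ∀ i, h i ≠ j := by
    by_contra! hcon
    have := Fintype.card_le_of_surjective h hcon
    simp at this
  have hr : Set.range h = Set.range j.succAbove := by
    have hsub : Set.range h ⊆ Set.range j.succAbove := by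
      rw [Fin.range_succAbove]
      rintro _ ⟨i, rfl⟩
      exact hj i
    refine Set.eq_of_subset_of_ncard_le hsub ?_
    rw [Set.ncard_range_of_injective h.injective,
      Set.ncard_range_of_injective Fin.succAbove_right_injective]
  rw [h.strictMono.range_inj (Fin.strictMono_succAbove j)] at hr
  have hd := hM (Pi.single j 1)
  rw [firstRowDet_apply, Matrix.det_succ_row_zero, sum_eq_single j] at hd
  · have hs : (M.updateRow 0 (Pi.single j 1)).submatrix Fin.succ j.succAbove =
        M.submatrix Fin.succ j.succAbove := by
      ext a b
      simp
    rw [hs] at hd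
    simpa [hr] using hd
  · intro b _ hb
    simp [hb]
  · simp

/-- The rows of an invertible matrix span, and so do their truncations to the first `m + 1` entries.
-/
theorem firstRowDet_eq_zero_of_rows {m : ℕ} {G : Matrix (Fin n) (Fin n) ℝ} (hG : IsUnit G)
    {M : Matrix (Fin (m + 1)) (Fin (m + 1)) ℝ} (hm : m + 1 ≤ n)
    (h : ∀ l, firstRowDet M (fun j => G l (Fin.castLE hm j)) = 0) (u : Fin (m + 1) → ℝ) :
    firstRowDet M u = 0 := by
  have hdet := (Matrix.isUnit_iff_isUnit_det G).1 hG
  let e : Fin (m + 1) → Fin n := Fin.castLE hm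
  have he : Function.Injective e := Fin.castLE_injective hm
  let U : Fin n → ℝ := Function.extend e u 0
  let c := Matrix.vecMul U G⁻¹
  have hU : Matrix.vecMul c G = U := by
    rw [Matrix.vecMul_vecMul, Matrix.nonsing_inv_mul _ hdet, Matrix.vecMul_one]
  have hu : u = ∑ l, c l • fun j => G l (e j) := by
    ext j
    have h1 : U (e j) = u j := he.extend_apply _ _ _
    rw [← h1, ← hU]
    simp [Matrix.vecMul, dotProduct]
  rw [hu, map_sum]
  refine sum_eq_zero fun l _ => ?_
  rw [map_smul, h l, smul_zero]

/-- Column sets of codegree at most one lie in the first `m + 1` columns, so these coefficients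
involve only cofactors of the first row. -/
theorem minorPoly_coeff_eq_zero_of_rows {m : ℕ} {G : Matrix (Fin n) (Fin n) ℝ} (hG : IsUnit G)
    (hm : m + 1 ≤ n) (hm' : m ≤ n) (w : (Fin m ↪o Fin n) → ℝ)
    (h : ∀ l, firstRowDet (swminor G (m + 1) hm) (fun j => G l (Fin.castLE hm j)) = 0)
    {d : ℕ} (hd : d ≤ 1) : (minorPoly hm' w G).coeff d = 0 := by
  rw [minorPoly_coeff]
  refine sum_eq_zero fun f _ => ?_
  split_ifs with hf
  · have hle : ∀ i : Fin m, (f i : ℕ) < m + 1 := by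
      intro i
      have h1 : (f i : ℕ) - i ≤ codeg f :=
        single_le_sum (f := fun i : Fin m => (f i : ℕ) - i) (fun _ _ => Nat.zero_le _) (mem_univ i)
      have := i.2
      omega
    have hmono : StrictMono fun i => (⟨f i, hle i⟩ : Fin (m + 1)) := fun i j hij => by
      have : f i < f j := f.strictMono hij
      exact this
    have h2 := det_submatrix_succ_eq_zero (firstRowDet_eq_zero_of_rows hG hm h)
      (OrderEmbedding.ofStrictMono _ hmono)
    have h3 : lowMinor hm' G f = 0 := by
      rw [← h2, lowMinor]
      congr 1
      ext a b
      simp only [swminor, Matrix.submatrix_apply, lastRow]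
      congr 1
      ext
      simp only [Fin.val_succ]
      omega
    rw [h3, zero_mul]
  · rfl

theorem isUnit_of_mem_Lo1 {L : Matrix (Fin n) (Fin n) ℝ} (hL : L ∈ Lo1 n) : IsUnit L := by
  rw [Matrix.isUnit_iff_isUnit_det, Matrix.det_of_isLowerTriangular L fun i j hij => hL.2 i j hij]
  simp [hL.1]

theorem polyCurve_polyCurve (N L : Matrix (Fin n) (Fin n) ℝ) (x t : ℝ) :
    polyCurve N (polyCurve N L x) t = polyCurve N L (t + x) := by
  rw [polyCurve, polyCurve, polyCurve, Matrix.mul_assoc, ← Matrix.exp_add_of_commute, ← add_smul,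
    add_comm]
  exact ((Commute.refl N).smul_left x).smul_right t

theorem isUnit_polyCurve (N : Matrix (Fin n) (Fin n) ℝ) {L : Matrix (Fin n) (Fin n) ℝ}
    (hL : L ∈ Lo1 n) (x : ℝ) : IsUnit (polyCurve N L x) :=
  (isUnit_of_mem_Lo1 hL).mul (Matrix.isUnit_exp _)

/-- Adds `s ^ (l + 1)` times the row `l` to the row `r`, for all `l < r`. -/
def addRows (L : Matrix (Fin n) (Fin n) ℝ) (r : Fin n) (s : ℝ) : Matrix (Fin n) (Fin n) ℝ :=
  (1 + Matrix.of fun i l => if i = r ∧ l < r then s ^ ((l : ℕ) + 1) else 0) * L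

theorem addRows_apply (L : Matrix (Fin n) (Fin n) ℝ) (r : Fin n) (s : ℝ) (i j : Fin n) :
    addRows L r s i j =
      L i j + if i = r then ∑ l, (if l < r then s ^ ((l : ℕ) + 1) else 0) * L l j else 0 := by
  rw [addRows, Matrix.add_mul, Matrix.one_mul, Matrix.add_apply, Matrix.mul_apply]
  congr 1
  by_cases h : i = r <;> simp [h]

theorem addRows_zero (L : Matrix (Fin n) (Fin n) ℝ) (r : Fin n) : addRows L r 0 = L := by
  ext i j
  simp [addRows_apply]

theorem addRows_mem_Lo1 {L : Matrix (Fin n) (Fin n) ℝ} (hL : L ∈ Lo1 n) (r : Fin n) (s : ℝ) :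
    addRows L r s ∈ Lo1 n := by
  have key : ∀ i j, i ≤ j →
      (if i = r then ∑ l, (if l < r then s ^ ((l : ℕ) + 1) else 0) * L l j else 0) = 0 := by
    intro i j hij
    split_ifs with hi
    · refine sum_eq_zero fun l _ => ?_
      split_ifs with hl
      · rw [hL.2 l j (hl.trans_le (hi ▸ hij)), mul_zero]
      · rw [zero_mul]
    · rfl
  refine ⟨fun i => ?_, fun i j hij => ?_⟩
  · rw [addRows_apply, key i i le_rfl, hL.1, add_zero]
  · rw [addRows_apply, key i j hij.le, hL.2 i j hij, add_zero]

theorem continuous_addRows (L : Matrix (Fin n) (Fin n) ℝ) (r : Fin n) :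
    Continuous (addRows L r) := by
  refine continuous_matrix fun i j => ?_
  simp only [addRows_apply]
  split_ifs
  · refine continuous_const.add (continuous_finsetSum _ fun l _ => ?_)
    split_ifs <;> fun_prop
  · fun_prop

theorem tendsto_minorPoly_addRows_coeff {k : ℕ} (hk : k ≤ n) (w : (Fin k ↪o Fin n) → ℝ)
    (L : Matrix (Fin n) (Fin n) ℝ) (r : Fin n) (d : ℕ) :
    Tendsto (fun s => (minorPoly hk w (addRows L r s)).coeff d) (𝓝[>] 0)
      (𝓝 ((minorPoly hk w L).coeff d)) := by
  have hc : Continuous fun s => (minorPoly hk w (addRows L r s)).coeff d := by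
    simp only [minorPoly_coeff]
    refine continuous_finsetSum _ fun f _ => ?_
    split_ifs
    · exact ((continuous_addRows L r).matrix_submatrix _ _).matrix_det.mul continuous_const
    · exact continuous_const
  have := hc.tendsto 0
  rw [addRows_zero] at this
  exact this.mono_left nhdsWithin_le_nhds

theorem minorPoly_addRows_of_lt {k : ℕ} (hk : k ≤ n) (w : (Fin k ↪o Fin n) → ℝ)
    (L : Matrix (Fin n) (Fin n) ℝ) {r : Fin n} (hr : (r : ℕ) < n - k) (s : ℝ) :
    minorPoly hk w (addRows L r s) = minorPoly hk w L := by
  have h : ∀ f : Fin k ↪o Fin n, lowMinor hk (addRows L r s) f = lowMinor hk L f := by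
    intro f
    rw [lowMinor, lowMinor]
    congr 1
    ext a b
    have : lastRow hk a ≠ r := by
      rintro rfl
      simp only [lastRow] at hr
      omega
    simp [addRows_apply, this]
  simp [minorPoly, h]

theorem det_swminor_addRows {m : ℕ} (hm : m + 1 ≤ n) (G : Matrix (Fin n) (Fin n) ℝ) (s : ℝ)
    {r : Fin n} (hr : (r : ℕ) = n - (m + 1)) :
    (swminor (addRows G r s) (m + 1) hm).det =
      firstRowDet (swminor G (m + 1) hm) (fun j => G r (Fin.castLE hm j)) +
      ∑ l, (if l < r then s ^ ((l : ℕ) + 1) else 0) *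
        firstRowDet (swminor G (m + 1) hm) (fun j => G l (Fin.castLE hm j)) := by
  simp_rw [← smul_eq_mul, ← map_smul]
  rw [← map_sum, ← map_add, firstRowDet_apply]
  congr 1
  ext a b
  rw [Matrix.updateRow_apply]
  have ha : a = 0 ↔ (⟨n - (m + 1) + a, by omega⟩ : Fin n) = r := by
    rw [Fin.ext_iff, Fin.ext_iff, hr]
    simp
  simp only [swminor, Matrix.submatrix_apply, addRows_apply]
  by_cases h : a = 0
  · rw [if_pos (ha.1 h), if_pos h, ha.1 h]
    simp only [Pi.add_apply, Finset.sum_apply, Pi.smul_apply, smul_eq_mul]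
  · rw [if_neg fun h' => h (ha.2 h'), if_neg h, add_zero]

theorem eventually_det_swminor_addRows_ne_zero {m : ℕ} (hm : m + 1 ≤ n)
    (G : Matrix (Fin n) (Fin n) ℝ) {r : Fin n} (hr : (r : ℕ) = n - (m + 1))
    (h : ∃ l, firstRowDet (swminor G (m + 1) hm) (fun j => G l (Fin.castLE hm j)) ≠ 0) :
    ∀ᶠ s in 𝓝[>] (0 : ℝ), (swminor (addRows G r s) (m + 1) hm).det ≠ 0 := by
  set D : Fin n → ℝ :=
    fun l => firstRowDet (swminor G (m + 1) hm) (fun j => G l (Fin.castLE hm j)) with hD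
  -- Distinct powers of `s` put each `D l` with `l ≤ r` in its own coefficient.
  set P : ℝ[X] := C (D r) + ∑ l : Fin n, C (if l < r then D l else 0) * X ^ ((l : ℕ) + 1) with hP
  have hev : ∀ s, (swminor (addRows G r s) (m + 1) hm).det = P.eval s := by
    intro s
    rw [det_swminor_addRows hm G s hr, hP, eval_add, eval_C, eval_finsetSum]
    congr 1
    refine sum_congr rfl fun l _ => ?_
    rw [eval_mul, eval_C, eval_pow, eval_X]
    split_ifs
    · rw [mul_comm]
    · rw [zero_mul, zero_mul]
  have hP0 : P ≠ 0 := by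
    intro h0
    obtain ⟨l, hl⟩ := h
    have hcoeff : ∀ d, P.coeff d = 0 := fun d => by rw [h0, coeff_zero]
    rcases lt_trichotomy l r with hlt | rfl | hgt
    · have := hcoeff (l + 1)
      simp only [hP, coeff_add, finsetSum_coeff, coeff_C_mul, coeff_X_pow, coeff_C_succ,
        zero_add] at this
      rw [sum_eq_single l] at this
      · simp only [if_true, mul_one, if_pos hlt] at this
        exact hl this
      · intro b _ hb
        rw [if_neg (c := (l : ℕ) + 1 = b + 1) fun h' => hb (Fin.ext (by omega)), mul_zero]
      · simp
    · have := hcoeff 0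
      simp only [hP, coeff_add, finsetSum_coeff, coeff_C_mul, coeff_X_pow, coeff_C_zero] at this
      rw [sum_eq_zero, add_zero] at this
      · exact hl this
      · intro b _
        rw [if_neg (c := 0 = (b : ℕ) + 1) (by omega), mul_zero]
    -- For `l > r`, row `l` already occurs in the minor at position `l - r`, so `D l = 0`.
    · rw [Fin.lt_def] at hgt
      have hl2 := l.2
      apply hl
      rw [firstRowDet_apply]
      have hne : (0 : Fin (m + 1)) ≠ ⟨l - r, by omega⟩ := by
        intro h'
        have := congrArg Fin.val h'
        simp only [Fin.val_zero] at this
        omega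
      refine Matrix.det_zero_of_row_eq hne ?_
      rw [Matrix.updateRow_self, Matrix.updateRow_ne hne.symm]
      ext j
      simp only [swminor, Matrix.submatrix_apply]
      congr 1
      ext
      simp only
      omega
  have hfin : ((P.roots.toFinset : Set ℝ) \ {0}).Finite := P.roots.toFinset.finite_toSet.sdiff
  have hmem : ((P.roots.toFinset : Set ℝ) \ {0})ᶜ ∈ 𝓝 (0 : ℝ) :=
    hfin.isClosed.isOpen_compl.mem_nhds (by simp)
  filter_upwards [nhdsWithin_le_nhds hmem, self_mem_nhdsWithin] with s hs (hs0 : 0 < s)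
  rw [hev]
  intro hroot
  refine hs ⟨?_, hs0.ne'⟩
  simpa using ⟨hP0, hroot⟩

section Curve

variable {N : Matrix (Fin n) (Fin n) ℝ} {w : ∀ k : Fin n, (Fin k ↪o Fin n) → ℝ}
  (hw : ∀ (k : Fin n) L t, mFun (polyCurve N L) k k.2.le t = (minorPoly k.2.le (w k) L).eval t)

include hw

/-- Moving the base point along the curve translates time, so the coefficients at `Γ(x)` record the
value and derivative at `x`. -/
theorem minorPoly_polyCurve (k : Fin n) (L : Matrix (Fin n) (Fin n) ℝ) (x : ℝ) :
    minorPoly k.2.le (w k) (polyCurve N L x) = taylor x (minorPoly k.2.le (w k) L) := by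
  refine Polynomial.funext fun t => ?_
  rw [taylor_eval, ← hw, ← hw, mFun, mFun, polyCurve_polyCurve]

theorem exists_firstRowDet_ne_zero {m : ℕ} (hm : m < n) (hm' : m + 1 ≤ n)
    {L : Matrix (Fin n) (Fin n) ℝ} (hL : L ∈ Lo1 n) {d : ℕ}
    (hs : RealSimple (minorPoly hm.le (w ⟨m, hm⟩) L) d) (x : ℝ) :
    ∃ l, firstRowDet (swminor (polyCurve N L x) (m + 1) hm')
      (fun j => polyCurve N L x l (Fin.castLE hm' j)) ≠ 0 := by
  by_contra! hcon
  have hz := fun d hd => minorPoly_coeff_eq_zero_of_rows (d := d) (isUnit_polyCurve N hL x) hm'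
    hm.le (w ⟨m, hm⟩) hcon hd
  have ht := minorPoly_polyCurve hw ⟨m, hm⟩ L x
  simp only at ht
  simp only [ht] at hz
  have h0 := hz 0 zero_le_one
  have h1 := hz 1 le_rfl
  rw [taylor_coeff_zero] at h0
  rw [taylor_coeff_one] at h1
  exact hs.derivative_eval_ne_zero h0 h1

theorem exists_realSimple_of_disjoint_lt
    (hex : ∃ L ∈ Lo1 n, ∀ k : Fin n, RealSimple (minorPoly k.2.le (w k) L) (k * (n - k)))
    (m : ℕ) (hm : m ≤ n) :
    ∃ L ∈ Lo1 n, (∀ k : Fin n, RealSimple (minorPoly k.2.le (w k) L) (k * (n - k))) ∧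
      ∀ k₁ k₂ : Fin n, k₁ < k₂ → (k₂ : ℕ) < m → ∀ t, (minorPoly k₁.2.le (w k₁) L).eval t = 0 →
        (minorPoly k₂.2.le (w k₂) L).eval t ≠ 0 := by
  induction m with
  | zero =>
    obtain ⟨L, hL, h⟩ := hex
    exact ⟨L, hL, h, fun k₁ k₂ _ h => absurd h (Nat.not_lt_zero _)⟩
  | succ m ih =>
    obtain ⟨L, hL, hs, hdis⟩ := ih (by omega)
    rcases m with _ | m
    · refine ⟨L, hL, hs, fun k₁ k₂ h1 h2 => ?_⟩
      rw [Fin.lt_def] at h1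
      omega
    -- Row `r` is the top row of the southwest block of size `K = m + 1` and is absent from all
    -- smaller blocks.
    set r : Fin n := ⟨n - (m + 1), by omega⟩ with hr
    set K : Fin n := ⟨m + 1, by omega⟩ with hK
    have hsame : ∀ k : Fin n, k < K → ∀ s,
        minorPoly k.2.le (w k) (addRows L r s) = minorPoly k.2.le (w k) L := by
      intro k hk s
      rw [Fin.lt_def] at hk
      refine minorPoly_addRows_of_lt _ _ _ ?_ s
      simp only [hr, hK] at hk ⊢
      omega
    have hsimple : ∀ᶠ s in 𝓝[>] (0 : ℝ), ∀ k : Fin n,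
        RealSimple (minorPoly k.2.le (w k) (addRows L r s)) (k * (n - k)) := by
      rw [eventually_all]
      exact fun k => (hs k).eventually (fun s => minorPoly_natDegree_le _ _ _)
        (tendsto_minorPoly_addRows_coeff _ _ _ _)
    have hne : ∀ x, ∀ᶠ s in 𝓝[>] (0 : ℝ),
        (minorPoly K.2.le (w K) (addRows L r s)).eval x ≠ 0 := by
      intro x
      have := eventually_det_swminor_addRows_ne_zero (Nat.le_of_succ_le hm) (polyCurve N L x)
        (r := r) rfl (exists_firstRowDet_ne_zero hw (Nat.lt_of_succ_lt hm) (Nat.le_of_succ_le hm)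
          hL (hs ⟨m, Nat.lt_of_succ_lt hm⟩) x)
      filter_upwards [this] with s hs
      -- Row operations multiply on the left, so they pass through the factor `exp (x N)`.
      rw [← hw, mFun, polyCurve, addRows, Matrix.mul_assoc]
      exact hs
    have hroots : ∀ᶠ s in 𝓝[>] (0 : ℝ), ∀ k : Fin n,
        ∀ x ∈ (minorPoly k.2.le (w k) L).roots.toFinset,
          (minorPoly K.2.le (w K) (addRows L r s)).eval x ≠ 0 := by
      rw [eventually_all]
      intro k
      rw [Finset.eventually_all]
      exact fun x _ => hne x
    obtain ⟨s, hs1, hs2⟩ := (hsimple.and hroots).exists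
    refine ⟨addRows L r s, addRows_mem_Lo1 hL r s, hs1, fun k₁ k₂ h12 h2 t ht => ?_⟩
    rcases Nat.lt_succ_iff_lt_or_eq.1 h2 with hlt | heq
    · have hK2 : k₂ < K := Fin.lt_def.2 hlt
      rw [hsame k₁ (h12.trans hK2)] at ht
      rw [hsame k₂ hK2]
      exact hdis k₁ k₂ h12 hlt t ht
    · obtain rfl : k₂ = K := Fin.ext heq
      rw [hsame k₁ h12] at ht
      exact hs2 k₁ t (by simpa using ⟨(hs k₁).1, ht⟩)

end Curve

/-! ### Root count and conclusion -/

theorem sum_mul_sub_eq (n : ℕ) :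
    (∑ k : Fin n, (((k : ℕ) * (n - k) : ℕ) : ℚ)) = ((n : ℚ) ^ 3 - n) / 6 := by
  -- The upper limit is freed from `n` so that induction applies.
  have h : ∀ m : ℕ, ∑ k ∈ range m, ((k : ℚ) * (n - k)) =
      n * (m * (m - 1) / 2) - (m - 1) * m * (2 * m - 1) / 6 := by
    intro m
    induction m with
    | zero => simp
    | succ m ih => rw [sum_range_succ, ih]; push_cast; ring
  rw [Fin.sum_univ_eq_sum_range (fun k => ((k * (n - k) : ℕ) : ℚ)) n]
  have h2 : ∑ k ∈ range n, (((k * (n - k) : ℕ) : ℚ)) = ∑ k ∈ range n, ((k : ℚ) * (n - k)) := by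
    refine sum_congr rfl fun k hk => ?_
    rw [Nat.cast_mul, Nat.cast_sub (mem_range.1 hk).le]
  rw [h2, h]
  ring

end

open Polynomial Finset in
theorem proposition3 (n : ℕ) (N₀ : Matrix (Fin n) (Fin n) ℝ) (hN₀ : N₀ ∈ posSubdiagonal n) :
    ∃ L₀ ∈ Lo1 n,
      -- each `m_k`, `1 ≤ k ≤ n - 1`, is a polynomial of degree `k (n - k)`,
      -- all of whose complex roots are real and simple
      (∀ (k : ℕ) (hk : k < n), 1 ≤ k →
        ∃ p : Polynomial ℝ,
          (∀ t : ℝ, mFun (polyCurve N₀ L₀) k hk.le t = p.eval t) ∧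
          p.natDegree = k * (n - k) ∧
          ∀ z : ℂ, (p.map (algebraMap ℝ ℂ)).IsRoot z →
            z.im = 0 ∧ (p.map (algebraMap ℝ ℂ)).rootMultiplicity z = 1) ∧
      -- different `m_k` have no common root
      (∀ (k₁ k₂ : ℕ) (hk₁ : k₁ < n) (hk₂ : k₂ < n), 1 ≤ k₁ → 1 ≤ k₂ → k₁ ≠ k₂ →
        ∀ t : ℝ, ¬ (mFun (polyCurve N₀ L₀) k₁ hk₁.le t = 0 ∧
          mFun (polyCurve N₀ L₀) k₂ hk₂.le t = 0)) ∧
      -- in total there are exactly `(n³ - n) / 6` real roots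
      (({t : ℝ | ∃ (k : ℕ) (hk : k < n), 1 ≤ k ∧ mFun (polyCurve N₀ L₀) k hk.le t = 0}.ncard : ℚ)
        = ((n : ℚ) ^ 3 - n) / 6) := by
  choose w hwpos hw' using fun k : Fin n => exists_weights hN₀ k.2.le
  have hw : ∀ (k : Fin n) L t,
      mFun (polyCurve N₀ L) k k.2.le t = (minorPoly k.2.le (w k) L).eval t := by
    intro k L t
    rw [hw', minorPoly_eval]
  obtain ⟨L, hL, hs, hdis⟩ :=
    exists_realSimple_of_disjoint_lt hw (exists_realSimple hwpos) n le_rfl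
  set p : Fin n → ℝ[X] := fun k => minorPoly k.2.le (w k) L with hp
  have hdis' : ∀ k₁ k₂ : Fin n, k₁ ≠ k₂ → ∀ t, (p k₁).eval t = 0 → (p k₂).eval t ≠ 0 := by
    intro k₁ k₂ hne t h1 h2
    rcases lt_or_gt_of_ne hne with h | h
    · exact hdis k₁ k₂ h k₂.2 t h1 h2
    · exact hdis k₂ k₁ h k₁.2 t h2 h1
  refine ⟨L, hL, ?_, ?_, ?_⟩
  · intro k hk _
    exact ⟨p ⟨k, hk⟩, hw ⟨k, hk⟩ L, (hs ⟨k, hk⟩).natDegree_eq,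
      fun z hz => (hs ⟨k, hk⟩).complex_roots hz⟩
  · rintro k₁ k₂ hk₁ hk₂ - - hne t ⟨h1, h2⟩
    rw [hw ⟨k₁, hk₁⟩] at h1
    rw [hw ⟨k₂, hk₂⟩] at h2
    exact hdis' ⟨k₁, hk₁⟩ ⟨k₂, hk₂⟩ (fun h => hne (congrArg Fin.val h)) t h1 h2
  · have hset : {t : ℝ | ∃ (k : ℕ) (hk : k < n), 1 ≤ k ∧
        mFun (polyCurve N₀ L) k hk.le t = 0} =
        ((univ.biUnion fun k : Fin n => (p k).roots.toFinset : Finset ℝ) : Set ℝ) := by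
      ext t
      simp only [Set.mem_ofPred_eq, coe_biUnion, Set.mem_iUnion, Finset.mem_coe, mem_univ,
        Multiset.mem_toFinset, exists_prop, true_and]
      constructor
      · rintro ⟨k, hk, -, h⟩
        rw [hw ⟨k, hk⟩] at h
        exact ⟨⟨k, hk⟩, (mem_roots (hs ⟨k, hk⟩).1).2 h⟩
      · rintro ⟨k, h⟩
        refine ⟨k, k.2, ?_, ?_⟩
        -- The index `k = 0` adds nothing to the union: its polynomial has no roots.
        · by_contra h0
          have hc := (hs k).card_roots
          simp only [show (k : ℕ) * (n - k) = 0 by simp [show (k : ℕ) = 0 by omega]] at hc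
          rw [Multiset.card_eq_zero.1 hc] at h
          simp at h
        · rw [hw k]
          exact (mem_roots (hs k).1).1 h
    rw [hset, Set.ncard_coe_finset, card_biUnion]
    · rw [Nat.cast_sum, ← sum_mul_sub_eq]
      refine sum_congr rfl fun k _ => ?_
      rw [Multiset.toFinset_card_of_nodup (hs k).nodup_roots, (hs k).card_roots]
    · intro k₁ _ k₂ _ hne
      rw [Function.onFun, Finset.disjoint_left]
      intro t h1 h2
      rw [Multiset.mem_toFinset] at h1 h2
      exact hdis' k₁ k₂ hne t ((mem_roots (hs k₁).1).1 h1) ((mem_roots (hs k₂).1).1 h2)
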